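/- Let $A$ be a commutative Noetherian ring of finite Krull dimension $d$ and let $0 \le i \le d$. For $j \ge 0$ let $\mathcal{M}_j(A)$ be the category of finitely generated $A$-modules of dimension $\le j$ (the zero module being counted in every $\mathcal{M}_j(A)$), and let $\mathcal{M}_{-1}(A) = 0$. Let $\mathcal{D}^b(A)$ be the bounded derived category of the category of finitely generated $A$-modules, let $\mathcal{D}^b_j(A) \subseteq \mathcal{D}^b(A)$ be the full triangulated subcategory of complexes $X$ with $H^n(X) \in \mathcal{M}_j(A)$ for all $n$ (so $\mathcal{D}^b_{-1}(A) = 0$), and let $\mathcal{C}_i(A) = \mathcal{D}^b_i(A)/\mathcal{D}^b_{i-1}(A)$ be the Verdier quotient. Let $\mathcal{C}_i^{\le 0}$ (respectively $\mathcal{C}_i^{\ge 0}$) be the class of objects of $\mathcal{C}_i(A)$ that are isomorphic in $\mathcal{C}_i(A)$ to some $Y \in \mathcal{D}^b_i(A)$ with $Y^n = 0$ for all $n > 0$ (respectively for all $n < 0$). Then $(\mathcal{C}_i^{\le 0}, \mathcal{C}_i^{\ge 0})$ is a bounded $t$-structure on $\mathcal{C}_i(A)$, and the functor sending a module $M \in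 \mathcal{M}_i(A)$ to the image in $\mathcal{C}_i(A)$ of the stalk complex with $M$ in degree $0$ induces an equivalence from the Serre quotient $\mathcal{M}_i(A)/\mathcal{M}_{i-1}(A)$ to the heart $\mathcal{C}_i^{\le 0} \cap \mathcal{C}_i^{\ge 0}$ of this $t$-structure. -/

import Mathlib

open CategoryTheory Limits Pretriangulated Triangulated

universe w u

namespace DimFiltration

noncomputable section

/-! ### Finitely generated modules of bounded dimension -/

section Modules

variable (A : Type u) [CommRing A]

/-- The finitely generated `A`-modules whose (Krull) dimension, i.e. the dimension of the support,
is `< n`. The zero module has dimension `⊥`, so `dimLT A 0` consists of the zero modules;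
the modules of dimension `≤ i` are those of `dimLT A (i + 1)`. -/
def dimLT (n : ℕ) : ObjectProperty (FGModuleCat.{u} A) :=
  fun M ↦ Module.supportDim A M < (n : WithBot ℕ∞)

theorem dimLT_succ_iff (i : ℕ) (M : FGModuleCat.{u} A) :
    dimLT A (i + 1) M ↔ Module.supportDim A M ≤ (i : WithBot ℕ∞) := by
  unfold dimLT
  generalize Module.supportDim A M = x
  induction x with
  | bot => exact iff_of_true (WithBot.bot_lt_coe _) bot_le
  | coe x =>
    change (x : WithBot ℕ∞) < ((i + 1 : ℕ) : ℕ∞) ↔ (x : WithBot ℕ∞) ≤ ((i : ℕ∞) : WithBot ℕ∞)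
    rw [WithBot.coe_lt_coe, WithBot.coe_le_coe]
    push_cast
    exact ENat.lt_add_one_iff (ENat.natCast_ne_top i)

theorem supportDim_le_max {M N P : Type u} [AddCommGroup M] [Module A M] [AddCommGroup N]
    [Module A N] [AddCommGroup P] [Module A P] (f : M →ₗ[A] N) (g : N →ₗ[A] P)
    (h : Function.Exact f g) (hf : Function.Injective f) (hg : Function.Surjective g) :
    Module.supportDim A N ≤ max (Module.supportDim A M) (Module.supportDim A P) := by
  refine iSup_le fun c ↦ ?_
  have hc : ((c 0 : Module.support A N) : PrimeSpectrum A) ∈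
      Module.support A M ∪ Module.support A P := by
    rw [← Module.support_of_exact h hf hg]
    exact (c 0).2
  have key (S : Set (PrimeSpectrum A)) (hS : ∀ p q : PrimeSpectrum A, p ≤ q → p ∈ S → q ∈ S)
      (h0 : ((c 0 : Module.support A N) : PrimeSpectrum A) ∈ S) :
      (c.length : WithBot ℕ∞) ≤ Order.krullDim S :=
    Order.LTSeries.length_le_krullDim (p := (⟨c.length,
      fun j ↦ ⟨(c j).1, hS _ _ (c.monotone (Fin.zero_le j)) h0⟩,
      fun j ↦ c.step j⟩ : LTSeries S))
  rcases hc with hc | hc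
  · exact (key _ (fun p q hpq hp ↦ Module.mem_support_mono hpq hp) hc).trans (le_max_left _ _)
  · exact (key _ (fun p q hpq hp ↦ Module.mem_support_mono hpq hp) hc).trans (le_max_right _ _)

variable [IsNoetherianRing A] (n : ℕ)

theorem injective_of_mono {M N : FGModuleCat.{u} A} (f : M ⟶ N) [Mono f] :
    Function.Injective f.hom.hom :=
  (ModuleCat.mono_iff_injective _).1
    (inferInstanceAs (Mono ((forget₂ (FGModuleCat A) (ModuleCat A)).map f)))

theorem surjective_of_epi {M N : FGModuleCat.{u} A} (f : M ⟶ N) [Epi f] :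
    Function.Surjective f.hom.hom :=
  (ModuleCat.epi_iff_surjective _).1
    (inferInstanceAs (Epi ((forget₂ (FGModuleCat A) (ModuleCat A)).map f)))

instance : (dimLT A n).IsSerreClass where
  exists_zero := by
    refine ⟨FGModuleCat.of A PUnit, ?_, ?_⟩
    · rw [IsZero.iff_id_eq_zero]
      ext x
    · have : Module.supportDim A PUnit.{u + 1} = ⊥ :=
        Module.supportDim_eq_bot_of_subsingleton _ _
      change Module.supportDim A PUnit.{u + 1} < _
      rw [this]
      exact WithBot.bot_lt_coe _
  prop_of_mono f _ h :=
    (Module.supportDim_le_of_injective f.hom.hom (injective_of_mono A f)).trans_lt h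
  prop_of_epi f _ h :=
    (Module.supportDim_le_of_surjective f.hom.hom (surjective_of_epi A f)).trans_lt h
  prop_X₂_of_shortExact {S} hS h₁ h₃ := by
    have := hS.mono_f
    have := hS.epi_g
    have hS' := (hS.map (forget₂ (FGModuleCat.{u} A) (ModuleCat.{u} A))).exact
    rw [ShortComplex.ShortExact.moduleCat_exact_iff_function_exact] at hS'
    exact (supportDim_le_max A S.f.hom.hom S.g.hom.hom hS' (injective_of_mono A S.f)
      (surjective_of_epi A S.g)).trans_lt (max_lt h₁ h₃)

end Modules

/-! ### Serre classes as abelian subcategories -/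

section Serre

variable {B : Type*} [Category* B] [Abelian B] (P : ObjectProperty B) [P.IsSerreClass]

instance : P.IsClosedUnderFiniteProducts :=
  have : P.IsClosedUnderBinaryProducts := by
    refine ⟨fun X ⟨p⟩ ↦ ?_⟩
    refine P.prop_of_iso ?_ (P.prop_biprod (p.prop_diag_obj ⟨.left⟩) (p.prop_diag_obj ⟨.right⟩))
    exact (biprod.isoProd _ _) ≪≫ (HasLimit.isoOfNatIso (diagramIsoPair p.diag).symm) ≪≫
      (limit.isLimit _).conePointUniqueUpToIso p.isLimit
  .mk'

instance : PreservesFiniteLimits P.ι :=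
  ((Functor.preservesFiniteLimits_tfae P.ι).out 2 3).1 P.preservesKernels_ι

instance : PreservesFiniteColimits P.ι :=
  ((Functor.preservesFiniteColimits_tfae P.ι).out 2 3).1 P.preservesCokernels_ι

/-- For Serre classes `P'` and `P` in `B` (with `P'` contained in `P`), the Serre quotient `P / P'`:
the localization of the abelian category `P` at the morphisms with kernel and cokernel in `P'`. -/
abbrev SerreQuotient (P P' : ObjectProperty B) [P.IsSerreClass] [P'.IsSerreClass] :=
  (P'.inverseImage P.ι).isoModSerre.Localization

/-- The quotient functor `P ⥤ P / P'`. -/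
abbrev SerreQuotient.Q (P P' : ObjectProperty B) [P.IsSerreClass] [P'.IsSerreClass] :
    P.FullSubcategory ⥤ SerreQuotient P P' :=
  (P'.inverseImage P.ι).isoModSerre.Q

end Serre

/-! ### Bounded complexes with cohomology in a Serre class, and Verdier quotients -/

section Derived

variable {B : Type*} [Category* B] [Abelian B] [HasDerivedCategory.{w} B]
  (P : ObjectProperty B)

/-- The objects of the bounded derived category of `B` (inside the derived category) all of whose
cohomology objects satisfy `P`. -/
def boundedCohomology : ObjectProperty (DerivedCategory B) :=
  (DerivedCategory.TStructure.t : TStructure (DerivedCategory B)).bounded ⊓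
    fun X ↦ ∀ n : ℤ, P ((DerivedCategory.homologyFunctor B n).obj X)

end Derived

section Derived

variable {B : Type*} [Category* B] [Abelian B] [HasDerivedCategory.{w} B]
  (P : ObjectProperty B) [P.IsSerreClass]

instance : (boundedCohomology P).IsClosedUnderIsomorphisms where
  of_iso e h := ⟨ObjectProperty.prop_of_iso _ e h.1, fun n ↦
    P.prop_of_iso ((DerivedCategory.homologyFunctor B n).mapIso e) (h.2 n)⟩

instance : (boundedCohomology P).IsTriangulated where
  exists_zero := ⟨_, isZero_zero (DerivedCategory B), ObjectProperty.prop_zero _, fun n ↦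
    P.prop_of_isZero ((DerivedCategory.homologyFunctor B n).map_isZero (isZero_zero _))⟩
  isStableUnderShiftBy a :=
    { le_shift := fun X hX ↦ ⟨ObjectProperty.le_shift _ a _ hX.1, fun n ↦
        P.prop_of_iso
          (((DerivedCategory.homologyFunctor B 0).shiftIso a n (a + n) rfl).app X).symm
          (hX.2 (a + n))⟩ }
  toIsTriangulatedClosed₂ := .mk' fun T hT h₁ h₃ ↦
    ⟨ObjectProperty.ext_of_isTriangulatedClosed₂ _ T hT h₁.1 h₃.1, fun n ↦
      P.prop_X₂_of_exact (DerivedCategory.HomologySequence.exact₂ T hT n) (h₁.2 n) (h₃.2 n)⟩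

theorem boundedCohomology_single (M : B) (hM : P M) :
    boundedCohomology P ((DerivedCategory.singleFunctor B 0).obj M) := by
  refine ⟨⟨⟨0, inferInstance⟩, ⟨0, inferInstance⟩⟩, fun n ↦ ?_⟩
  rcases lt_trichotomy n 0 with h | rfl | h
  · exact P.prop_of_isZero (DerivedCategory.isZero_of_isGE _ 0 n h)
  · exact P.prop_of_iso
      ((HomologicalComplex.homologyFunctorSingleIso B (ComplexShape.up ℤ) 0).symm.app M ≪≫
        ((DerivedCategory.homologyFunctorFactors B 0).symm.app _) ≪≫
        (DerivedCategory.homologyFunctor B 0).mapIso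
          ((DerivedCategory.singleFunctorIsoCompQ B 0).symm.app M)) hM
  · exact P.prop_of_isZero (DerivedCategory.isZero_of_isLE _ 0 n h)

/-- For Serre classes `P'` and `P` (with `P'` contained in `P`), the objects of `D^b_P(B)` lying
in `D^b_{P'}(B)`. -/
abbrev boundedCohomologyIn (P P' : ObjectProperty B) [P.IsSerreClass] [P'.IsSerreClass] :
    ObjectProperty (boundedCohomology P).FullSubcategory :=
  (boundedCohomology P').inverseImage (boundedCohomology P).ι

/-- The Verdier quotient `D^b_P(B) / D^b_{P'}(B)`: the localization of `D^b_P(B)` at the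
morphisms whose cone lies in `D^b_{P'}(B)`. -/
abbrev VerdierQuotient (P P' : ObjectProperty B) [P.IsSerreClass] [P'.IsSerreClass] :=
  (boundedCohomologyIn P P').trW.Localization

/-- The quotient functor `D^b_P(B) ⥤ D^b_P(B) / D^b_{P'}(B)`. -/
abbrev VerdierQuotient.Q (P P' : ObjectProperty B) [P.IsSerreClass] [P'.IsSerreClass] :
    (boundedCohomology P).FullSubcategory ⥤ VerdierQuotient P P' :=
  (boundedCohomologyIn P P').trW.Q

/-- The objects of the Verdier quotient that are isomorphic in it to (the image of) a complex `Y`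
in `D^b_P(B)` with `Y^n = 0` for `n > 0`. -/
def verdierLEZero (P P' : ObjectProperty B) [P.IsSerreClass] [P'.IsSerreClass] :
    ObjectProperty (VerdierQuotient P P') :=
  ((DerivedCategory.TStructure.t.le 0).inverseImage (boundedCohomology P).ι).map
    (VerdierQuotient.Q P P')

/-- The objects of the Verdier quotient that are isomorphic in it to (the image of) a complex `Y`
in `D^b_P(B)` with `Y^n = 0` for `n < 0`. -/
def verdierGEZero (P P' : ObjectProperty B) [P.IsSerreClass] [P'.IsSerreClass] :
    ObjectProperty (VerdierQuotient P P') :=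
  ((DerivedCategory.TStructure.t.ge 0).inverseImage (boundedCohomology P).ι).map
    (VerdierQuotient.Q P P')

/-- The functor `P ⥤ D^b_P(B)` sending an object to its stalk complex in degree `0`. -/
def stalk : P.FullSubcategory ⥤ (boundedCohomology P).FullSubcategory :=
  (boundedCohomology P).lift (P.ι ⋙ DerivedCategory.singleFunctor B 0)
    fun M ↦ boundedCohomology_single P M.obj M.property

end Derived

/-! ### The categories attached to a ring -/

section Ring

variable (A : Type u) [CommRing A] [IsNoetherianRing A] (i : ℕ)

/-- `M_i(A) / M_{i-1}(A)`, where `M_i(A)` is the category of finitely generated `A`-modules of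
dimension `≤ i`, and `M_{-1}(A)` consists of the zero modules. -/
abbrev MQuot := SerreQuotient (dimLT A (i + 1)) (dimLT A i)

/-- `C_i(A) = D^b_i(A) / D^b_{i-1}(A)`, where `D^b_i(A)` consists of the bounded complexes of
finitely generated `A`-modules with cohomology of dimension `≤ i`, and `D^b_{-1}(A) = 0`. -/
abbrev CQuot [HasDerivedCategory.{w} (FGModuleCat.{u} A)] :=
  VerdierQuotient (dimLT A (i + 1)) (dimLT A i)

end Ring

end

end DimFiltration

/-!
The statement holds for any two Serre classes `P` and `P'` in an abelian category `B`
(`verdierQuotient_heart`); of the finitely generated modules of dimension `≤ i` and `≤ i - 1`, only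
the fact that they form Serre classes is used.

The long exact sequence of cohomology shows that a morphism of `D^b_P(B)` is inverted in
`D^b_P(B) / D^b_{P'}(B)` if and only if it induces isomorphisms modulo `P'` on all cohomology
objects (`trW_iff_isoModSerre_cohomology`). Therefore, if a complex has cohomology in `P'` in
positive (resp. negative) degrees, then it can be replaced in the quotient by its canonical
truncation (`exists_truncLE_trW`, `exists_truncGE_trW`).

A morphism in the quotient is a roof `X ⟵ Z ⟶ Y`. When `X` lies in degrees `≤ 0`, the positive
cohomology of `Z` is in `P'`, and `Z` can be replaced by its truncation in degrees `≤ 0`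
(`exists_roof`). If `Y` lies in degrees `≥ 1`, the morphism `Z ⟶ Y` then vanishes, which is the
orthogonality axiom of a t-structure; the other axioms and the boundedness are inherited from
`D^b_P(B)` (`tQuotient`).

Cohomology modulo `P'` is defined on the quotient (`quotientCohomology`). An object of the heart is
the image of a complex in degrees `≤ 0`, whose negative cohomology has to be in `P'`, and truncating
it in degrees `≥ 0` gives a stalk complex: the functor from `P / P'` to the heart is essentially
surjective. It is faithful because degree `0` cohomology modulo `P'` recovers a morphism of `P`
modulo `P'`, and full because a roof between stalk complexes can be truncated to a roof of stalk
complexes (`exists_stalk_roof`).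
-/

namespace DimFiltration

/-! ### Morphisms modulo a Serre class and long exact sequences -/

section SerreInverseImage

variable {B B' : Type*} [Category* B] [Abelian B] [Category* B'] [Abelian B']
  (P : ObjectProperty B) [P.IsSerreClass] (F : B' ⥤ B)
  [PreservesFiniteLimits F] [PreservesFiniteColimits F]

lemma isoModSerre_inverseImage_iff {X Y : B'} (f : X ⟶ Y) :
    (P.inverseImage F).isoModSerre f ↔ P.isoModSerre (F.map f) :=
  and_congr (P.prop_iff_of_iso (PreservesKernel.iso F f))
    (P.prop_iff_of_iso (PreservesCokernel.iso F f))

lemma prop_image_inverseImage_iff {X Y : B'} (f : X ⟶ Y) :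
    P.inverseImage F (Abelian.image f) ↔ P (Abelian.image (F.map f)) := by
  refine P.prop_iff_of_iso (PreservesKernel.iso F _ ≪≫
    kernel.mapIso _ _ (Iso.refl _) (PreservesCokernel.iso F f) ?_)
  simp

end SerreInverseImage

section Exact

variable {B : Type*} [Category* B] [Abelian B] (P : ObjectProperty B) [P.IsSerreClass]

/-- In an exact sequence `K ⟶ X ⟶ Y ⟶ Q` with `K` and `Q` in a Serre class, the middle morphism
is an isomorphism modulo this class. -/
lemma isoModSerre_of_exact {K X Y Q : B} {i : K ⟶ X} {f : X ⟶ Y} {p : Y ⟶ Q} {wi : i ≫ f = 0}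
    {wp : f ≫ p = 0} (hi : (ShortComplex.mk i f wi).Exact) (hp : (ShortComplex.mk f p wp).Exact)
    (hK : P K) (hQ : P Q) : P.isoModSerre f := by
  have := hi.epi_kernelLift
  have := hp.mono_cokernelDesc
  exact ⟨P.prop_of_epi (kernel.lift f i wi) hK, P.prop_of_mono (cokernel.desc f p wp) hQ⟩

/-- In an exact sequence `X ⟶ Y ⟶ C ⟶ X' ⟶ Y'`, the object `C` is an extension of the kernel of
`X' ⟶ Y'` by the cokernel of `X ⟶ Y`. -/
lemma prop_of_exact {X Y C X' Y' : B} {f : X ⟶ Y} {p : Y ⟶ C} {δ : C ⟶ X'} {g : X' ⟶ Y'}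
    {w₁ : f ≫ p = 0} {w₂ : p ≫ δ = 0} {w₃ : δ ≫ g = 0}
    (h : (ShortComplex.mk p δ w₂).Exact) (hf : P (cokernel f)) (hg : P (kernel g)) : P C := by
  let S : ShortComplex B := ShortComplex.mk (cokernel.desc f p w₁) (kernel.lift g δ w₃)
    (by ext; simp [w₂])
  let S' : ShortComplex B := ShortComplex.mk p (kernel.lift g δ w₃) (by ext; simp [w₂])
  let φ : S' ⟶ ShortComplex.mk p δ w₂ :=
    { τ₁ := 𝟙 _, τ₂ := 𝟙 _, τ₃ := kernel.ι g
      comm₁₂ := by simp [S']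
      comm₂₃ := by simp [S'] }
  let ψ : S' ⟶ S :=
    { τ₁ := cokernel.π f, τ₂ := 𝟙 _, τ₃ := 𝟙 _
      comm₁₂ := by simp [S', S]
      comm₂₃ := by simp [S', S] }
  have : Epi ψ.τ₁ := inferInstanceAs (Epi (cokernel.π f))
  have : Mono φ.τ₃ := inferInstanceAs (Mono (kernel.ι g))
  have : Epi φ.τ₁ := inferInstanceAs (Epi (𝟙 _))
  have : IsIso φ.τ₂ := inferInstanceAs (IsIso (𝟙 _))
  have : IsIso ψ.τ₂ := inferInstanceAs (IsIso (𝟙 _))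
  have : Mono ψ.τ₃ := inferInstanceAs (Mono (𝟙 _))
  have hS' : S'.Exact := (ShortComplex.exact_iff_of_epi_of_isIso_of_mono φ).2 h
  exact P.prop_X₂_of_exact ((ShortComplex.exact_iff_of_epi_of_isIso_of_mono ψ).1 hS') hf hg

end Exact

section DerivedCategory

variable {B : Type*} [Category* B] [Abelian B] [HasDerivedCategory.{w} B]

open DerivedCategory

/-- The cohomology of the cone of a morphism lies in a Serre class if and only if the morphism
induces isomorphisms on cohomology modulo this Serre class. -/
lemma forall_homology_obj₃_iff (P : ObjectProperty B) [P.IsSerreClass]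
    {T : Triangle (DerivedCategory B)} (hT : T ∈ distTriang _) :
    (∀ n, P ((homologyFunctor B n).obj T.obj₃)) ↔
      ∀ n, P.isoModSerre ((homologyFunctor B n).map T.mor₁) :=
  ⟨fun h n ↦ isoModSerre_of_exact P (HomologySequence.exact₁ T hT (n - 1) n)
      (HomologySequence.exact₂ T hT n) (h _) (h _),
    fun h n ↦ prop_of_exact P (w₁ := by
        rw [← Functor.map_comp, comp_distTriang_mor_zero₁₂ _ hT, Functor.map_zero])
      (w₃ := (HomologySequence.δ_comp T hT n (n + 1)))
      (HomologySequence.exact₃ T hT n (n + 1)) (h n).2 (h (n + 1)).1⟩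

/-- If the third object of a distinguished triangle lies in degrees `≥ a`, the first morphism is
an isomorphism on cohomology in degrees `< a`. -/
lemma isIso_homology_mor₁ {T : Triangle (DerivedCategory B)} (hT : T ∈ distTriang _) {a : ℤ}
    (h₃ : TStructure.t.IsGE T.obj₃ a) {n : ℤ} (hn : n < a) :
    IsIso ((homologyFunctor B n).map T.mor₁) := by
  have : Mono ((homologyFunctor B n).map T.mor₁) :=
    (HomologySequence.mono_homologyMap_mor₁_iff T hT (n - 1) n).2
      ((isZero_of_isGE T.obj₃ a (n - 1) (by lia)).eq_of_src _ _)
  have : Epi ((homologyFunctor B n).map T.mor₁) :=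
    (HomologySequence.epi_homologyMap_mor₁_iff T hT n).2
      ((isZero_of_isGE T.obj₃ a n hn).eq_of_tgt _ _)
  exact isIso_of_mono_of_epi _

/-- If the first object of a distinguished triangle lies in degrees `≤ a`, the second morphism is
an isomorphism on cohomology in degrees `> a`. -/
lemma isIso_homology_mor₂ {T : Triangle (DerivedCategory B)} (hT : T ∈ distTriang _) {a : ℤ}
    (h₁ : TStructure.t.IsLE T.obj₁ a) {n : ℤ} (hn : a < n) :
    IsIso ((homologyFunctor B n).map T.mor₂) := by
  have : Mono ((homologyFunctor B n).map T.mor₂) :=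
    (HomologySequence.mono_homologyMap_mor₂_iff T hT n).2
      ((isZero_of_isLE T.obj₁ a n hn).eq_of_src _ _)
  have : Epi ((homologyFunctor B n).map T.mor₂) :=
    (HomologySequence.epi_homologyMap_mor₂_iff T hT n (n + 1)).2
      ((isZero_of_isLE T.obj₁ a (n + 1) (by lia)).eq_of_tgt _ _)
  exact isIso_of_mono_of_epi _

/-- `D^b_P(B)` is stable under the canonical truncations. -/
instance (P : ObjectProperty B) [P.IsSerreClass] :
    (boundedCohomology P).HasInducedTStructure TStructure.t where
  exists_triangle_zero_one X hX := by
    obtain ⟨Y, Z, hY, hZ, f, g, h, hT⟩ := TStructure.t.exists_triangle X 0 1 rfl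
    obtain ⟨bY, bZ⟩ := TStructure.t.bounded.mem_of_hasInductedTStructure TStructure.t _ hT 0 1 rfl
      ⟨hY⟩ hX.1 ⟨hZ⟩
    refine ⟨Y, Z, ⟨hY⟩, ⟨hZ⟩, f, g, h, hT,
      ObjectProperty.le_isoClosure _ _ ⟨bY, fun n ↦ ?_⟩,
      ObjectProperty.le_isoClosure _ _ ⟨bZ, fun n ↦ ?_⟩⟩
    · by_cases hn : n < 1
      · have : IsIso ((homologyFunctor B n).map f) := isIso_homology_mor₁ hT ⟨hZ⟩ hn
        exact P.prop_of_iso (asIso ((homologyFunctor B n).map f)).symm (hX.2 n)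
      · have : TStructure.t.IsLE Y 0 := ⟨hY⟩
        exact P.prop_of_isZero (isZero_of_isLE Y 0 n (by lia))
    · by_cases hn : n < 1
      · have : TStructure.t.IsGE Z 1 := ⟨hZ⟩
        exact P.prop_of_isZero (isZero_of_isGE Z 1 n hn)
      · have : IsIso ((homologyFunctor B n).map g) := isIso_homology_mor₂ hT ⟨hY⟩ (by lia)
        exact P.prop_of_iso (asIso ((homologyFunctor B n).map g)) (hX.2 n)

end DerivedCategory

/-! ### The canonical t-structure on `D^b_P(B)` modulo `P'` -/

noncomputable section BoundedCohomology

variable {B : Type*} [Category* B] [Abelian B] [HasDerivedCategory.{w} B]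
  (P P' : ObjectProperty B) [P.IsSerreClass] [P'.IsSerreClass]

/-- The canonical t-structure on `D^b_P(B)`. -/
abbrev tBounded : TStructure (boundedCohomology P).FullSubcategory :=
  (boundedCohomology P).tStructure DerivedCategory.TStructure.t

/-- The cohomology functor `H^n : D^b_P(B) ⥤ B`. -/
abbrev cohomology (n : ℤ) : (boundedCohomology P).FullSubcategory ⥤ B :=
  (boundedCohomology P).ι ⋙ DerivedCategory.homologyFunctor B n

variable {P} in
lemma isZero_cohomology_of_isLE (X : (boundedCohomology P).FullSubcategory) (a n : ℤ) (hn : a < n)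
    [h : (tBounded P).IsLE X a] : IsZero ((cohomology P n).obj X) :=
  have : DerivedCategory.TStructure.t.IsLE X.obj a := ⟨h.1⟩
  DerivedCategory.isZero_of_isLE X.obj a n hn

variable {P} in
lemma isZero_cohomology_of_isGE (X : (boundedCohomology P).FullSubcategory) (a n : ℤ) (hn : n < a)
    [h : (tBounded P).IsGE X a] : IsZero ((cohomology P n).obj X) :=
  have : DerivedCategory.TStructure.t.IsGE X.obj a := ⟨h.1⟩
  DerivedCategory.isZero_of_isGE X.obj a n hn

/-- The morphisms inverted in the Verdier quotient are the isomorphisms on cohomology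
modulo `P'`. -/
lemma trW_iff_isoModSerre_cohomology {X Y : (boundedCohomology P).FullSubcategory} (s : X ⟶ Y) :
    (boundedCohomologyIn P P').trW s ↔ ∀ n, P'.isoModSerre ((cohomology P n).map s) := by
  obtain ⟨Z, g, h, hT⟩ := distinguished_cocone_triangle s
  refine ((boundedCohomologyIn P P').trW_iff_of_distinguished _ hT).trans (Iff.trans ?_
    (forall_homology_obj₃_iff P' ((boundedCohomology P).ι.map_distinguished _ hT)))
  exact ⟨fun h ↦ h.2, fun h ↦ ⟨Z.property.1, h⟩⟩

variable {P}

/-- The truncation in degrees `≤ 0` of a complex with cohomology in `P'` in positive degrees is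
isomorphic to it in the Verdier quotient. -/
lemma exists_truncLE_trW (X : (boundedCohomology P).FullSubcategory)
    (hX : ∀ n, 0 < n → P' ((cohomology P n).obj X)) :
    ∃ (Y : (boundedCohomology P).FullSubcategory) (s : Y ⟶ X), (tBounded P).IsLE Y 0 ∧
      (boundedCohomologyIn P P').trW s := by
  obtain ⟨Y, Z, hY, hZ, s, g, h, hT⟩ := (tBounded P).exists_triangle X 0 1 rfl
  have : (tBounded P).IsLE Y 0 := ⟨hY⟩
  refine ⟨Y, s, inferInstance, (trW_iff_isoModSerre_cohomology P P' s).2 fun n ↦ ?_⟩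
  by_cases hn : n < 1
  · have : IsIso ((cohomology P n).map s) :=
      isIso_homology_mor₁ ((boundedCohomology P).ι.map_distinguished _ hT) ⟨hZ⟩ hn
    exact P'.isoModSerre_of_isIso _
  · have hY' := isZero_cohomology_of_isLE Y 0 n (by lia)
    rw [hY'.eq_of_src ((cohomology P n).map s) 0, P'.isoModSerre_zero_iff]
    exact ⟨P'.prop_of_isZero hY', hX n (by lia)⟩

/-- The truncation in degrees `≥ 0` of a complex `X` with cohomology in `P'` in negative degrees is
isomorphic to it in the Verdier quotient, and is universal among morphisms from `X` to complexes
in degrees `≥ 0`. -/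
lemma exists_truncGE_trW (X : (boundedCohomology P).FullSubcategory)
    (hX : ∀ n, n < 0 → P' ((cohomology P n).obj X)) :
    ∃ (Y : (boundedCohomology P).FullSubcategory) (s : X ⟶ Y), (tBounded P).IsGE Y 0 ∧
      ((tBounded P).IsLE X 0 → (tBounded P).IsLE Y 0) ∧
      (boundedCohomologyIn P P').trW s ∧
      ∀ (Z : (boundedCohomology P).FullSubcategory) (_ : (tBounded P).IsGE Z 0) (f : X ⟶ Z),
        ∃ g, f = s ≫ g := by
  obtain ⟨K, Y, hK, hY, k, s, h, hT⟩ := (tBounded P).exists_triangle X (-1) 0 rfl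
  have : (tBounded P).IsLE K (-1) := ⟨hK⟩
  have : (tBounded P).IsGE Y 0 := ⟨hY⟩
  have hs {n : ℤ} (hn : -1 < n) : IsIso ((cohomology P n).map s) :=
    isIso_homology_mor₂ ((boundedCohomology P).ι.map_distinguished _ hT) ⟨hK⟩ hn
  refine ⟨Y, s, inferInstance, fun _ ↦ ?_, (trW_iff_isoModSerre_cohomology P P' s).2 fun n ↦ ?_,
    fun Z _ f ↦ Triangle.yoneda_exact₂ _ hT f
      ((tBounded P).zero_of_isLE_of_isGE _ (-1) 0 (by lia) ⟨hK⟩ inferInstance)⟩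
  · rw [ObjectProperty.tStructure_isLE_iff]
    refine (DerivedCategory.isLE_iff _ _).2 fun n hn ↦ ?_
    have := hs (n := n) (by lia)
    exact (isZero_cohomology_of_isLE X 0 n hn).of_iso (asIso ((cohomology P n).map s)).symm
  · by_cases hn : -1 < n
    · have := hs hn
      exact P'.isoModSerre_of_isIso _
    · have hY' := isZero_cohomology_of_isGE Y 0 n (by lia)
      rw [hY'.eq_of_tgt ((cohomology P n).map s) 0, P'.isoModSerre_zero_iff]
      exact ⟨hX n (by lia), P'.prop_of_isZero hY'⟩

variable {P'} in
/-- Denominators with target in degrees `≤ 0` can be refined to have source in degrees `≤ 0`. This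
is where it matters that `P'` is closed under subobjects and quotients: the positive cohomology
of `X'` lies in `P'`. -/
lemma exists_isLE_trW {X X' : (boundedCohomology P).FullSubcategory} (s : X' ⟶ X)
    (hs : (boundedCohomologyIn P P').trW s) [(tBounded P).IsLE X 0] :
    ∃ (Y : (boundedCohomology P).FullSubcategory) (u : Y ⟶ X'), (tBounded P).IsLE Y 0 ∧
      (boundedCohomologyIn P P').trW u := by
  refine exists_truncLE_trW P' X' fun n hn ↦ ?_
  have h := (trW_iff_isoModSerre_cohomology P P' s).1 hs n
  rw [(isZero_cohomology_of_isLE X 0 n hn).eq_of_tgt ((cohomology P n).map s) 0,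
    P'.isoModSerre_zero_iff] at h
  exact h.1

instance (M : P.FullSubcategory) : (tBounded P).IsLE ((stalk P).obj M) 0 :=
  ⟨(inferInstance : (((DerivedCategory.singleFunctor B 0).obj M.obj).IsLE 0)).1⟩

instance (M : P.FullSubcategory) : (tBounded P).IsGE ((stalk P).obj M) 0 :=
  ⟨(inferInstance : (((DerivedCategory.singleFunctor B 0).obj M.obj).IsGE 0)).1⟩

instance : (stalk P).Full := by
  unfold stalk; infer_instance

instance : (stalk P).Faithful := by
  unfold stalk; infer_instance

variable (P) in
/-- The stalk complex of `M` has cohomology `M` in degree `0`. -/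
def stalkCompCohomologyIso : stalk P ⋙ cohomology P 0 ≅ P.ι :=
  Functor.isoWhiskerLeft P.ι (DerivedCategory.singleFunctorCompHomologyFunctorIso B 0)

lemma exists_iso_stalk (X : (boundedCohomology P).FullSubcategory) [hl : (tBounded P).IsLE X 0]
    [hg : (tBounded P).IsGE X 0] : ∃ M : P.FullSubcategory, Nonempty (X ≅ (stalk P).obj M) := by
  have : DerivedCategory.TStructure.t.IsLE X.obj 0 := ⟨hl.1⟩
  have : DerivedCategory.TStructure.t.IsGE X.obj 0 := ⟨hg.1⟩
  obtain ⟨M, ⟨e⟩⟩ := DerivedCategory.exists_iso_singleFunctor_obj_of_isGE_of_isLE X.obj 0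
  have hM : P M := P.prop_of_iso ((DerivedCategory.homologyFunctor B 0).mapIso e ≪≫
    (DerivedCategory.singleFunctorCompHomologyFunctorIso B 0).app M) (X.property.2 0)
  exact ⟨⟨M, hM⟩, ⟨ObjectProperty.isoMk _ e⟩⟩

/-- A morphism of objects of `P` has kernel and cokernel in `P'` if and only if it becomes
invertible on stalk complexes in the Verdier quotient. -/
lemma trW_stalk_map_iff {M N : P.FullSubcategory} (f : M ⟶ N) :
    (boundedCohomologyIn P P').trW ((stalk P).map f) ↔ (P'.inverseImage P.ι).isoModSerre f := by
  have h₀ : P'.isoModSerre ((cohomology P 0).map ((stalk P).map f)) ↔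
      P'.isoModSerre (P.ι.map f) :=
    P'.isoModSerre.arrow_mk_iso_iff
      (((Functor.mapArrowFunctor _ _).mapIso (stalkCompCohomologyIso P)).app (Arrow.mk f))
  rw [trW_iff_isoModSerre_cohomology, isoModSerre_inverseImage_iff, ← h₀]
  refine ⟨fun h ↦ h 0, fun h n ↦ ?_⟩
  by_cases hn : n = 0
  · subst hn
    exact h
  · have hZ (M : P.FullSubcategory) : IsZero ((cohomology P n).obj ((stalk P).obj M)) := by
      rcases lt_or_gt_of_ne hn with hn | hn
      · exact isZero_cohomology_of_isGE _ 0 n hn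
      · exact isZero_cohomology_of_isLE _ 0 n hn
    rw [(hZ M).eq_of_src ((cohomology P n).map ((stalk P).map f)) 0, P'.isoModSerre_zero_iff]
    exact ⟨P'.prop_of_isZero (hZ M), P'.prop_of_isZero (hZ N)⟩

end BoundedCohomology

/-! ### The t-structure on the Verdier quotient and its heart -/

noncomputable section Quotient

variable {B : Type*} [Category* B] [Abelian B] [HasDerivedCategory.{w} B]
  (P P' : ObjectProperty B) [P.IsSerreClass] [P'.IsSerreClass]

variable {P P'} in
/-- If `X` lies in degrees `≤ 0`, then a morphism out of `X` in the Verdier quotient is a fraction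
whose numerator and denominator start from an object lying in degrees `≤ 0`. -/
lemma exists_roof {X Y : (boundedCohomology P).FullSubcategory} [(tBounded P).IsLE X 0]
    (f : (VerdierQuotient.Q P P').obj X ⟶ (VerdierQuotient.Q P P').obj Y) :
    ∃ (Z : (boundedCohomology P).FullSubcategory) (s : Z ⟶ X) (g : Z ⟶ Y),
      (tBounded P).IsLE Z 0 ∧ (boundedCohomologyIn P P').trW s ∧
        (VerdierQuotient.Q P P').map s ≫ f = (VerdierQuotient.Q P P').map g := by
  obtain ⟨φ, rfl⟩ := Localization.exists_rightFraction (VerdierQuotient.Q P P')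
    (boundedCohomologyIn P P').trW f
  obtain ⟨Z, u, hZ, hu⟩ := exists_isLE_trW φ.s φ.hs
  refine ⟨Z, u ≫ φ.s, u ≫ φ.f, hZ, MorphismProperty.comp_mem _ _ _ hu φ.hs, ?_⟩
  rw [Functor.map_comp, Functor.map_comp, Category.assoc,
    MorphismProperty.RightFraction.map_s_comp_map]

/-- The t-structure on the Verdier quotient, for which the quotient functor is t-exact. -/
def tQuotient : TStructure (VerdierQuotient P P') where
  le n := ((tBounded P).le n).map (VerdierQuotient.Q P P')
  ge n := ((tBounded P).ge n).map (VerdierQuotient.Q P P')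
  le_shift n a n' h X hX := by
    obtain ⟨Y, hY, ⟨e⟩⟩ := hX
    exact ⟨Y⟦a⟧, (tBounded P).le_shift n a n' h Y hY,
      ⟨((VerdierQuotient.Q P P').commShiftIso a).app Y ≪≫ (shiftFunctor _ a).mapIso e⟩⟩
  ge_shift n a n' h X hX := by
    obtain ⟨Y, hY, ⟨e⟩⟩ := hX
    exact ⟨Y⟦a⟧, (tBounded P).ge_shift n a n' h Y hY,
      ⟨((VerdierQuotient.Q P P').commShiftIso a).app Y ≪≫ (shiftFunctor _ a).mapIso e⟩⟩
  zero' X Y f hX hY := by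
    obtain ⟨X, hX, ⟨e⟩⟩ := hX
    obtain ⟨Y, hY, ⟨e'⟩⟩ := hY
    have : (tBounded P).IsLE X 0 := ⟨hX⟩
    obtain ⟨Z, s, g, hZ, hs, h⟩ := exists_roof (e.hom ≫ f ≫ e'.inv)
    have := Localization.inverts (VerdierQuotient.Q P P') _ s hs
    -- the numerator goes from degrees `≤ 0` to degrees `≥ 1`
    rw [(tBounded P).zero_of_isLE_of_isGE g 0 1 (by lia) hZ ⟨hY⟩, Functor.map_zero] at h
    rw [← cancel_mono e'.inv, ← cancel_epi e.hom, ← cancel_epi ((VerdierQuotient.Q P P').map s), h]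
    simp
  le_zero_le := by
    rintro X ⟨Y, hY, ⟨e⟩⟩
    exact ⟨Y, (tBounded P).le_zero_le _ hY, ⟨e⟩⟩
  ge_one_le := by
    rintro X ⟨Y, hY, ⟨e⟩⟩
    exact ⟨Y, (tBounded P).ge_one_le _ hY, ⟨e⟩⟩
  exists_triangle_zero_one A := by
    have := Localization.essSurj (VerdierQuotient.Q P P') (boundedCohomologyIn P P').trW
    let e := (VerdierQuotient.Q P P').objObjPreimageIso A
    obtain ⟨X, Y, hX, hY, f, g, h, hT⟩ := (tBounded P).exists_triangle_zero_one
      ((VerdierQuotient.Q P P').objPreimage A)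
    refine ⟨_, _, ObjectProperty.prop_map_obj _ _ hX, ObjectProperty.prop_map_obj _ _ hY,
      (VerdierQuotient.Q P P').map f ≫ e.hom, e.inv ≫ (VerdierQuotient.Q P P').map g,
      (VerdierQuotient.Q P P').map h ≫ ((VerdierQuotient.Q P P').commShiftIso (1 : ℤ)).hom.app X,
      isomorphic_distinguished _ ((VerdierQuotient.Q P P').map_distinguished _ hT) _
      (Triangle.isoMk _ _ (Iso.refl _) e.symm (Iso.refl _) ?_ ?_ ?_)⟩
    · change ((VerdierQuotient.Q P P').map f ≫ e.hom) ≫ e.inv =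
        𝟙 _ ≫ (VerdierQuotient.Q P P').map f
      simp
    · exact Category.comp_id _
    · exact (congrArg (_ ≫ ·) (CategoryTheory.Functor.map_id _ _)).trans
        ((Category.comp_id _).trans (Category.id_comp _).symm)

lemma tQuotient_bounded : (tQuotient P P').bounded = ⊤ := by
  refine top_le_iff.1 fun X _ ↦ ?_
  have := Localization.essSurj (VerdierQuotient.Q P P') (boundedCohomologyIn P P').trW
  let Y := (VerdierQuotient.Q P P').objPreimage X
  have e : (VerdierQuotient.Q P P').obj Y ≅ X := (VerdierQuotient.Q P P').objObjPreimageIso X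
  obtain ⟨⟨a, ha⟩, ⟨b, hb⟩⟩ := Y.property.1
  exact ⟨⟨a, ⟨Y, ha.1, ⟨e⟩⟩⟩, ⟨b, ⟨Y, hb.1, ⟨e⟩⟩⟩⟩

/-- Cohomology in degree `n` modulo `P'`, as a functor on the Verdier quotient. -/
def quotientCohomology (n : ℤ) : VerdierQuotient P P' ⥤ P'.isoModSerre.Localization :=
  Localization.lift (cohomology P n ⋙ P'.isoModSerre.Q)
    (fun _ _ s hs ↦ Localization.inverts P'.isoModSerre.Q P'.isoModSerre _
      ((trW_iff_isoModSerre_cohomology P P' s).1 hs n)) (VerdierQuotient.Q P P')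

/-- On the image of a complex, `quotientCohomology` is its cohomology modulo `P'`. -/
def quotientCohomologyIso (n : ℤ) : VerdierQuotient.Q P P' ⋙ quotientCohomology P P' n ≅
    cohomology P n ⋙ P'.isoModSerre.Q :=
  Localization.fac _ _ _

variable {P P'} in
/-- The cohomology modulo `P'` of a complex only depends on its image in the Verdier quotient. -/
lemma prop_cohomology_of_isZero {X Y : (boundedCohomology P).FullSubcategory} {n : ℤ}
    (e : (VerdierQuotient.Q P P').obj X ≅ (VerdierQuotient.Q P P').obj Y)
    (hX : IsZero ((cohomology P n).obj X)) : P' ((cohomology P n).obj Y) := by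
  rw [← ObjectProperty.SerreClassLocalization.isZero_obj_iff P'.isoModSerre.Q P']
  exact (P'.isoModSerre.Q.map_isZero hX).of_iso
    ((quotientCohomologyIso P P' n).symm.app Y ≪≫
      (quotientCohomology P P' n).mapIso e.symm ≪≫ (quotientCohomologyIso P P' n).app X)

variable {P P'} in
/-- Every object of the heart is the image of a stalk complex. -/
lemma exists_iso_of_heart (X : VerdierQuotient P P') (hX : (tQuotient P P').heart X) :
    ∃ M : P.FullSubcategory, Nonempty ((VerdierQuotient.Q P P').obj ((stalk P).obj M) ≅ X) := by
  obtain ⟨⟨Y, hY, ⟨e⟩⟩, ⟨Z, hZ, ⟨e'⟩⟩⟩ := hX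
  have : (tBounded P).IsLE Y 0 := ⟨hY⟩
  have : (tBounded P).IsGE Z 0 := ⟨hZ⟩
  -- `Y` lies in degrees `≤ 0` and has cohomology in `P'` in degrees `< 0`
  obtain ⟨K, s, hK, hK', hs, -⟩ := exists_truncGE_trW P' Y fun n hn ↦
    prop_cohomology_of_isZero (e' ≪≫ e.symm) (isZero_cohomology_of_isGE Z 0 n hn)
  have := hK' inferInstance
  obtain ⟨M, ⟨i⟩⟩ := exists_iso_stalk K
  exact ⟨M, ⟨(VerdierQuotient.Q P P').mapIso i.symm ≪≫
    (Localization.isoOfHom (VerdierQuotient.Q P P') _ s hs).symm ≪≫ e⟩⟩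

/-- The functor from `P` to the heart sending an object to its stalk complex in degree `0`. -/
def stalkHeart : P.FullSubcategory ⥤ (tQuotient P P').heart.FullSubcategory :=
  (tQuotient P P').heart.lift (stalk P ⋙ VerdierQuotient.Q P P') fun M ↦
    ⟨ObjectProperty.prop_map_obj _ _ ((tBounded P).le_of_isLE ((stalk P).obj M) 0),
      ObjectProperty.prop_map_obj _ _ ((tBounded P).ge_of_isGE ((stalk P).obj M) 0)⟩

lemma stalkHeart_inverts : (P'.inverseImage P.ι).isoModSerre.IsInvertedBy (stalkHeart P P') := by
  intro M N f hf
  rw [← isIso_iff_of_reflects_iso _ (tQuotient P P').heart.ι]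
  exact Localization.inverts (VerdierQuotient.Q P P') _ _ ((trW_stalk_map_iff P' f).2 hf)

/-- The functor from the Serre quotient to the heart induced by `stalkHeart`. -/
def serreQuotientToHeart : SerreQuotient P P' ⥤ (tQuotient P P').heart.FullSubcategory :=
  Localization.lift (stalkHeart P P') (stalkHeart_inverts P P') (SerreQuotient.Q P P')

/-- On the image of an object of `P`, `serreQuotientToHeart` is its stalk complex. -/
def serreQuotientToHeartIso :
    SerreQuotient.Q P P' ⋙ serreQuotientToHeart P P' ≅ stalkHeart P P' :=
  Localization.fac _ _ _

instance : (serreQuotientToHeart P P').EssSurj where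
  mem_essImage X := by
    obtain ⟨M, ⟨e⟩⟩ := exists_iso_of_heart X.obj X.property
    exact ⟨(SerreQuotient.Q P P').obj M,
      ⟨(serreQuotientToHeartIso P P').app M ≪≫ ObjectProperty.isoMk _ e⟩⟩

/-- Degree `0` cohomology on the heart recovers the object of `P` modulo `P'`. -/
def stalkHeartCompCohomologyIso :
    stalkHeart P P' ⋙ (tQuotient P P').heart.ι ⋙ quotientCohomology P P' 0 ≅
      P.ι ⋙ P'.isoModSerre.Q :=
  Functor.isoWhiskerLeft (stalk P) (quotientCohomologyIso P P' 0) ≪≫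
    Functor.isoWhiskerRight (stalkCompCohomologyIso P) P'.isoModSerre.Q

instance : (serreQuotientToHeart P P').Faithful := by
  refine Functor.faithful_of_comp_of_hasLeftCalculusOfFractions (SerreQuotient.Q P P')
    (P'.inverseImage P.ι).isoModSerre _ fun M N f g h ↦ ?_
  have h₁ : (stalkHeart P P').map f = (stalkHeart P P').map g := by
    rw [← NatIso.naturality_1 (serreQuotientToHeartIso P P') f,
      ← NatIso.naturality_1 (serreQuotientToHeartIso P P') g]
    exact congr((serreQuotientToHeartIso P P').inv.app M ≫ $h ≫
      (serreQuotientToHeartIso P P').hom.app N)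
  have h₂ : P'.isoModSerre.Q.map (P.ι.map f) = P'.isoModSerre.Q.map (P.ι.map g) := by
    have e := stalkHeartCompCohomologyIso P P'
    have hf := NatIso.naturality_1 e f
    have hg := NatIso.naturality_1 e g
    simp only [Functor.comp_map, h₁] at hf hg
    exact hf.symm.trans hg
  rw [← sub_eq_zero, ← Functor.map_sub,
    ObjectProperty.SerreClassLocalization.map_eq_zero_iff _ (P'.inverseImage P.ι),
    prop_image_inverseImage_iff,
    ← ObjectProperty.SerreClassLocalization.map_eq_zero_iff P'.isoModSerre.Q P',
    Functor.map_sub, Functor.map_sub, h₂, sub_self]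

variable {P P'} in
/-- A morphism between stalk complexes in the Verdier quotient is a fraction of morphisms
between stalk complexes. -/
lemma exists_stalk_roof {M N : P.FullSubcategory}
    (f : (VerdierQuotient.Q P P').obj ((stalk P).obj M) ⟶
      (VerdierQuotient.Q P P').obj ((stalk P).obj N)) :
    ∃ (K : P.FullSubcategory) (s : K ⟶ M) (g : K ⟶ N), (P'.inverseImage P.ι).isoModSerre s ∧
      (VerdierQuotient.Q P P').map ((stalk P).map s) ≫ f =
        (VerdierQuotient.Q P P').map ((stalk P).map g) := by
  obtain ⟨Z, s, g, hZ, hs, h⟩ := exists_roof f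
  have hZ' (n : ℤ) (hn : n < 0) : P' ((cohomology P n).obj Z) :=
    prop_cohomology_of_isZero (Localization.isoOfHom (VerdierQuotient.Q P P') _ s hs).symm
      (isZero_cohomology_of_isGE ((stalk P).obj M) 0 n hn)
  -- `Z` lies in degrees `≤ 0`, hence its truncation `Y` in degrees `≥ 0` is a stalk complex, and
  -- both legs of the roof factor through it
  obtain ⟨Y, q, hY, hY', hq, hfac⟩ := exists_truncGE_trW P' Z hZ'
  have := hY' hZ
  obtain ⟨K, ⟨i⟩⟩ := exists_iso_stalk Y
  obtain ⟨s', rfl⟩ := hfac _ inferInstance s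
  obtain ⟨g', rfl⟩ := hfac _ inferInstance g
  obtain ⟨s'', hs''⟩ := (stalk P).map_surjective (i.inv ≫ s')
  obtain ⟨g'', hg''⟩ := (stalk P).map_surjective (i.inv ≫ g')
  have := Localization.inverts (VerdierQuotient.Q P P') _ q hq
  refine ⟨K, s'', g'', (trW_stalk_map_iff P' s'').1 ?_, ?_⟩
  · have hs' : (boundedCohomologyIn P P').trW s' := by
      rw [trW_iff_isoModSerre_cohomology] at hs hq ⊢
      refine fun n ↦ P'.isoModSerre.of_precomp ((cohomology P n).map q) _ (hq n) ?_
      rw [← Functor.map_comp]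
      exact hs n
    rw [hs'']
    exact MorphismProperty.comp_mem _ _ _ (ObjectProperty.trW_of_isIso _ _) hs'
  · rw [Functor.map_comp, Functor.map_comp, Category.assoc, cancel_epi] at h
    rw [hs'', hg'', Functor.map_comp, Functor.map_comp, Category.assoc, h]

instance : (serreQuotientToHeart P P').Full := by
  have := Localization.essSurj (SerreQuotient.Q P P') (P'.inverseImage P.ι).isoModSerre
  refine Functor.full_of_comp_essSurj _ (SerreQuotient.Q P P') fun M N φ ↦ ?_
  let e := serreQuotientToHeartIso P P'
  obtain ⟨K, s, g, hs, h⟩ := exists_stalk_roof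
    ((tQuotient P P').heart.ι.map (e.inv.app M ≫ φ ≫ e.hom.app N))
  have h' : (stalkHeart P P').map s ≫ e.inv.app M ≫ φ ≫ e.hom.app N = (stalkHeart P P').map g :=
    ObjectProperty.hom_ext _ h
  have := Localization.inverts (SerreQuotient.Q P P') _ s hs
  refine ⟨inv ((SerreQuotient.Q P P').map s) ≫ (SerreQuotient.Q P P').map g, ?_⟩
  have hs₁ := NatIso.naturality_2 e s
  have hg₁ := NatIso.naturality_2 e g
  rw [Functor.comp_map] at hs₁ hg₁
  rw [Functor.map_comp, Functor.map_inv, IsIso.inv_comp_eq, ← hs₁, ← hg₁, ← h']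
  simp

/-- For Serre classes `P` and `P'` of any abelian category, the canonical t-structure of `D^b_P(B)`
induces a bounded t-structure on `D^b_P(B) / D^b_{P'}(B)` with heart `P / P'`. -/
theorem verdierQuotient_heart :
    ∃ t : TStructure (VerdierQuotient P P'),
      t.le 0 = verdierLEZero P P' ∧ t.ge 0 = verdierGEZero P P' ∧ t.bounded = ⊤ ∧
      ∃ e : SerreQuotient P P' ≌ t.heart.FullSubcategory,
        Nonempty (SerreQuotient.Q P P' ⋙ e.functor ⋙ t.heart.ι ≅
          stalk P ⋙ VerdierQuotient.Q P P') := by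
  have : (serreQuotientToHeart P P').IsEquivalence := { }
  exact ⟨tQuotient P P', rfl, rfl, tQuotient_bounded P P',
    (serreQuotientToHeart P P').asEquivalence,
    ⟨Functor.isoWhiskerRight (serreQuotientToHeartIso P P') (tQuotient P P').heart.ι⟩⟩

end Quotient

end DimFiltration

theorem mainTheorem2 (A : Type u) [CommRing A] [IsNoetherianRing A]
    [HasDerivedCategory.{w} (FGModuleCat.{u} A)]
    (d : ℕ) (hd : ringKrullDim A = d) (i : ℕ) (hi : i ≤ d) :
    ∃ t : TStructure (DimFiltration.CQuot A i),
      t.le 0 = DimFiltration.verdierLEZero (DimFiltration.dimLT A (i + 1)) (DimFiltration.dimLT A i) ∧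
      t.ge 0 = DimFiltration.verdierGEZero (DimFiltration.dimLT A (i + 1)) (DimFiltration.dimLT A i) ∧
      t.bounded = ⊤ ∧
      ∃ e : DimFiltration.MQuot A i ≌ t.heart.FullSubcategory,
        Nonempty (DimFiltration.SerreQuotient.Q (DimFiltration.dimLT A (i + 1))
              (DimFiltration.dimLT A i) ⋙ e.functor ⋙ t.heart.ι ≅
            DimFiltration.stalk (DimFiltration.dimLT A (i + 1)) ⋙
              DimFiltration.VerdierQuotient.Q (DimFiltration.dimLT A (i + 1))
                (DimFiltration.dimLT A i)) :=
  DimFiltration.verdierQuotient_heart _ _
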